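/- Let $d\ge 1$ and $m\ge 0$ be integers, and for $L\in\mathbb N$ let $\Lambda_L=[-L,L]\cap\mathbb Z$. Let $(Y_i)_{i\in\mathbb Z^d}$ be identically distributed real random variables on a probability space with $\mathbb E[Y_i]=0$ and $\mathbb E[|Y_i|^3]<\infty$. Suppose the array is $m$-dependent: for any two finite sets $I,J\subset\mathbb Z^d$ with $|i-j|>m$ for all $i\in I$, $j\in J$, where $|n|=\sum_{v=1}^d|n_v|$, the families $(Y_i)_{i\in I}$ and $(Y_j)_{j\in J}$ are independent. (1) If the limit $$\sigma^2=\lim_{L\to\infty}\frac1{(2L+1)^d}\operatorname{Var}\Bigl(\sum_{i\in\Lambda_L^d}Y_i\Bigr)$$ exists and is finite, then $$\frac1{(2L+1)^{d/2}}\sum_{i\in\Lambda_L^d}Y_i\ \overset{d}{\longrightarrow}\ N(0,\sigma^2)\qquad (L\to\infty),$$ where $N(0,0)$ denotes the point mass at $0$. (2) If the array is identically distributed in the sense that its joint law is invariant under translations, i.e. for every $k\in\mathbb Z^d$ the array $(Y_{i+k})_{i\in\mathbb Z^d}$ has the same law as $(Y_i)_{i\in\mathbb Z^d}$, then this limit $\sigma^2\in[0,\infty)$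 exists, and hence the convergence in distribution to $N(0,\sigma^2)$ holds. -/

import Mathlib

open MeasureTheory ProbabilityTheory Filter Topology
open scoped NNReal

/-- The discrete cube `Λ_L^d = ([-L, L] ∩ ℤ)^d`. -/
noncomputable def box (d L : ℕ) : Finset (Fin d → ℤ) :=
  Fintype.piFinset fun _ => Finset.Icc (-(L : ℤ)) (L : ℤ)

/-- The `ℓ¹` norm on `ℤ^d`. -/
def l1Norm {d : ℕ} (n : Fin d → ℤ) : ℤ := ∑ v, |n v|

/-- An array indexed by `ℤ^d` is `m`-dependent if the subfamilies over any two finite index sets at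
mutual distance greater than `m` are independent. -/
def IsMDependent {d : ℕ} {Ω : Type*} [MeasurableSpace Ω] (m : ℕ) (Y : (Fin d → ℤ) → Ω → ℝ)
    (μ : Measure Ω) : Prop :=
  ∀ I J : Finset (Fin d → ℤ), (∀ i ∈ I, ∀ j ∈ J, (m : ℤ) < l1Norm (i - j)) →
    IndepFun (fun ω (i : I) => Y i ω) (fun ω (j : J) => Y j ω) μ

/-- The joint law of the array is invariant under all translations of `ℤ^d`. -/
def IsStationaryArray {d : ℕ} {Ω : Type*} [MeasurableSpace Ω] (Y : (Fin d → ℤ) → Ω → ℝ)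
    (μ : Measure Ω) : Prop :=
  ∀ k : Fin d → ℤ, IdentDistrib (fun ω (i : Fin d → ℤ) => Y (i + k) ω) (fun ω i => Y i ω) μ μ

/-- The sum of the array over the cube `Λ_L^d`. -/
noncomputable def boxSum {d : ℕ} {Ω : Type*} (Y : (Fin d → ℤ) → Ω → ℝ) (L : ℕ) (ω : Ω) : ℝ :=
  ∑ i ∈ box d L, Y i ω

/-- `(2L+1)^{-d/2} ∑_{i ∈ Λ_L^d} Y_i`. -/
noncomputable def normalizedBoxSum {d : ℕ} {Ω : Type*} (Y : (Fin d → ℤ) → Ω → ℝ) (L : ℕ)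
    (ω : Ω) : ℝ :=
  1 / (2 * (L : ℝ) + 1) ^ ((d : ℝ) / 2) * boxSum Y L ω

/-- `(2L+1)^{-d} Var(∑_{i ∈ Λ_L^d} Y_i)`. -/
noncomputable def normalizedVariance {d : ℕ} {Ω : Type*} [MeasurableSpace Ω]
    (Y : (Fin d → ℤ) → Ω → ℝ) (μ : Measure Ω) (L : ℕ) : ℝ :=
  1 / (2 * (L : ℝ) + 1) ^ d * variance (boxSum Y L) μ

/-!
The proof is Stein's method in Tikhomirov's form, run on characteristic functions. Let `S` be the
sum of the `Y i` over a finite set, and `f t = 𝔼[exp(itS)]`, so that `f' t = i ∑ 𝔼[Y i exp(itS)]`.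
Let `U i` and `V i` be the sums of the array over the sites within distance `m`, respectively `2m`,
of `i`. By `m`-dependence `Y i` is independent of `S - U i`, and `Y i * U i` is independent of
`S - V i`. Expanding `exp(itS)` around `exp(it(S - U i))` to second order and then, in the
first-order term, decoupling `Y i * U i - 𝔼[Y i * U i]` from `exp(it(S - V i))` gives
`𝔼[Y i exp(itS)] = it 𝔼[Y i * U i] f t + O(t²)`, where the error involves third moments only
(`norm_integral_mul_cexp_sub_le`). As `∑ 𝔼[Y i * U i] = Var S`, this says that
`f' = - t (Var S) f + O(n t²)` with `n` the number of sites, and solving this differential equation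
(`norm_sub_exp_le_of_deriv`) yields `|f t - exp(-t² Var S / 2)| ≤ C n |t|³`
(`norm_integral_cexp_sum_sub_le`, `IsMDependent.exists_norm_integral_cexp_sub_le`).

Evaluated at `t / √n`, the error is `C |t|³ / √n`, so Lévy's convergence theorem reduces the central
limit theorem to the convergence of `Var S / n`; a vanishing limit needs no separate treatment.
For a stationary array, `Var S / n` is the sum over displacements `k` in the cube of radius `m` of
`𝔼[Y 0 * Y k]` times the proportion of sites `i` with `i + k` in the cube, which tends to `1`
(`IsMDependent.tendsto_normalizedVariance`).
-/

/-! ### Stein's equation for characteristic functions -/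

/-- Second-order Taylor bound, with the non-optimal constant `1` in place of `1 / 2`. -/
lemma norm_cexp_mul_I_sub_one_sub_le (x : ℝ) :
    ‖Complex.exp (x * Complex.I) - 1 - x * Complex.I‖ ≤ x ^ 2 := by
  have hd : ∀ y ∈ Set.Icc (-|x|) |x|, HasDerivWithinAt
      (fun y : ℝ => Complex.exp (y * Complex.I) - 1 - y * Complex.I)
      ((Complex.exp (y * Complex.I) - 1) * Complex.I) (Set.Icc (-|x|) |x|) y := by
    intro y _
    have h1 : HasDerivAt (fun y : ℝ => (y : ℂ) * Complex.I) Complex.I y := by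
      simpa using (Complex.ofRealCLM.hasDerivAt (x := y)).mul_const Complex.I
    have := ((h1.cexp.sub_const 1).sub h1)
    convert! this.hasDerivWithinAt using 1
    ring
  have := (convex_Icc (-|x|) |x|).norm_image_sub_le_of_norm_hasDerivWithin_le (C := |x|) hd
    (fun y hy => by
      rw [norm_mul, Complex.norm_I, mul_one, mul_comm]
      exact Real.norm_exp_I_mul_ofReal_sub_one_le.trans (abs_le.2 hy))
    (x := 0) (y := x) (by simp) (by simp [neg_abs_le, le_abs_self])
  simpa [← pow_two] using this

/-- The pointwise form of the Stein expansion, with `x` a summand of `s`. The second and third terms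
have mean zero when `s - u` and `s - v` are sums over sites far from those in `x` and `x * u`, so the
bound controls `𝔼[x exp(its)] - it ρ 𝔼[exp(its)]` for `ρ = 𝔼[xu]`. -/
lemma norm_stein_integrand_le (t x u v s ρ : ℝ) :
    ‖(x : ℂ) * Complex.exp ((t * s : ℝ) * Complex.I)
      - x * Complex.exp ((t * (s - u) : ℝ) * Complex.I)
      - t * Complex.I * ((x * u - ρ : ℝ) * Complex.exp ((t * (s - v) : ℝ) * Complex.I))
      - t * Complex.I * ρ * Complex.exp ((t * s : ℝ) * Complex.I)‖
      ≤ t ^ 2 * (|x| * u ^ 2 + |x * u - ρ| * |v|) := by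
  have e1 : Complex.exp ((t * (s - u) : ℝ) * Complex.I)
      = Complex.exp ((t * s : ℝ) * Complex.I) * Complex.exp ((-(t * u) : ℝ) * Complex.I) := by
    rw [← Complex.exp_add]; congr 1; push_cast; ring
  have e2 : Complex.exp ((t * (s - v) : ℝ) * Complex.I)
      = Complex.exp ((t * s : ℝ) * Complex.I) * Complex.exp ((-(t * v) : ℝ) * Complex.I) := by
    rw [← Complex.exp_add]; congr 1; push_cast; ring
  have e3 : (x : ℂ) * Complex.exp ((t * s : ℝ) * Complex.I)
      - x * Complex.exp ((t * (s - u) : ℝ) * Complex.I)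
      - t * Complex.I * ((x * u - ρ : ℝ) * Complex.exp ((t * (s - v) : ℝ) * Complex.I))
      - t * Complex.I * ρ * Complex.exp ((t * s : ℝ) * Complex.I)
      = Complex.exp ((t * s : ℝ) * Complex.I) *
        (-(x * (Complex.exp ((-(t * u) : ℝ) * Complex.I) - 1 - (-(t * u) : ℝ) * Complex.I))
        - t * Complex.I * ((x * u - ρ : ℝ) *
          (Complex.exp ((-(t * v) : ℝ) * Complex.I) - 1))) := by
    rw [e1, e2]; push_cast; ring
  rw [e3, norm_mul, Complex.norm_exp_ofReal_mul_I, one_mul]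
  refine (norm_sub_le _ _).trans ?_
  rw [norm_neg, norm_mul, norm_mul, norm_mul, norm_mul, Complex.norm_I, Complex.norm_real,
    Complex.norm_real, Complex.norm_real, mul_one]
  have h1 := norm_cexp_mul_I_sub_one_sub_le (-(t * u))
  have h2 : ‖Complex.exp ((-(t * v) : ℝ) * Complex.I) - 1‖ ≤ ‖-(t * v)‖ := by
    rw [mul_comm]; exact Real.norm_exp_I_mul_ofReal_sub_one_le
  calc _ ≤ ‖x‖ * (-(t * u)) ^ 2 + ‖t‖ * (‖x * u - ρ‖ * ‖-(t * v)‖) := by gcongr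
    _ = _ := by
      simp only [Real.norm_eq_abs, abs_neg, abs_mul]
      linear_combination (|x * u - ρ| * |v|) * sq_abs t

/-- Only powers that are integrable under a third moment appear on the right, so no Hölder inequality
is needed to integrate the error term. -/
lemma third_order_le (x u v ρ : ℝ) :
    |x| * u ^ 2 + |x * u - ρ| * |v| ≤
      2 * |x| ^ 3 + 2 * |u| ^ 3 + |v| ^ 3 + |ρ| * (1 + |v| ^ 3) := by
  have key : ∀ a b c : ℝ, 0 ≤ a → 0 ≤ b → 0 ≤ c → a * b * c ≤ a ^ 3 + b ^ 3 + c ^ 3 := by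
    intro a b c ha hb hc
    nlinarith [mul_nonneg (add_nonneg (add_nonneg ha hb) hc) (add_nonneg (add_nonneg
      (sq_nonneg (a - b)) (sq_nonneg (b - c))) (sq_nonneg (a - c))), pow_nonneg ha 3,
      pow_nonneg hb 3, pow_nonneg hc 3]
  have h1 : |x| * u ^ 2 ≤ |x| ^ 3 + |u| ^ 3 := by
    have hx := abs_nonneg x
    have hu := abs_nonneg u
    rw [← sq_abs u]
    nlinarith [mul_nonneg (add_nonneg hx hu) (sq_nonneg (|x| - |u|)), pow_nonneg hx 3,
      pow_nonneg hu 3, mul_nonneg hx (sq_nonneg (|x| - |u|)),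
      mul_nonneg hu (sq_nonneg (|x| - |u|))]
  have h2 := key |x| |u| |v| (abs_nonneg _) (abs_nonneg _) (abs_nonneg _)
  have h3 : |x * u - ρ| * |v| ≤ |x| * |u| * |v| + |ρ| * |v| := by
    rw [← abs_mul x u, ← add_mul]
    gcongr
    exact abs_sub _ _
  have h4 : |v| ≤ 1 + |v| ^ 3 := by
    nlinarith [abs_nonneg v, sq_nonneg (|v| - 1), pow_nonneg (abs_nonneg v) 3,
      mul_nonneg (abs_nonneg v) (sq_nonneg (|v| - 1))]
  nlinarith [mul_le_mul_of_nonneg_left h4 (abs_nonneg ρ)]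

lemma abs_mul_le_one_add (x u : ℝ) : |x * u| ≤ 1 + |x| ^ 3 + |u| ^ 3 := by
  have hsq : ∀ a : ℝ, 0 ≤ a → a ^ 2 ≤ 1 + a ^ 3 := fun a ha => by
    nlinarith [mul_nonneg ha (sq_nonneg (a - 1)), sq_nonneg (a - 1), pow_nonneg ha 3]
  rw [abs_mul]
  nlinarith [sq_nonneg (|x| - |u|), hsq _ (abs_nonneg x), hsq _ (abs_nonneg u),
    pow_nonneg (abs_nonneg x) 3, pow_nonneg (abs_nonneg u) 3]

section Stein

variable {Ω : Type*} [MeasurableSpace Ω] {μ : Measure Ω}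

lemma integrable_mul_cexp {X S : Ω → ℝ} (hX : Integrable X μ) (hS : Measurable S) (t : ℝ) :
    Integrable (fun ω => (X ω : ℂ) * Complex.exp ((t * S ω : ℝ) * Complex.I)) μ := by
  refine hX.ofReal.mul_bdd (c := 1) (Measurable.aestronglyMeasurable (by fun_prop)) ?_
  exact ae_of_all _ fun ω => (Complex.norm_exp_ofReal_mul_I _).le

lemma integral_mul_cexp_eq_zero {X S : Ω → ℝ} (hXm : Measurable X) (hS : Measurable S)
    (hind : IndepFun X S μ) (h0 : ∫ ω, X ω ∂μ = 0) (t : ℝ) :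
    ∫ ω, (X ω : ℂ) * Complex.exp ((t * S ω : ℝ) * Complex.I) ∂μ = 0 := by
  have := hind.integral_fun_comp_mul_comp (f := fun x : ℝ => (x : ℂ))
    (g := fun x : ℝ => Complex.exp ((t * x : ℝ) * Complex.I)) hXm.aemeasurable hS.aemeasurable
    (Measurable.aestronglyMeasurable (by fun_prop)) (Measurable.aestronglyMeasurable (by fun_prop))
  rw [this, integral_complex_ofReal, h0]; simp

lemma MeasureTheory.MemLp.integrable_abs_pow_three {X : Ω → ℝ} (hX : MemLp X 3 μ) :
    Integrable (fun ω => |X ω| ^ 3) μ := by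
  simpa using hX.integrable_norm_pow (p := 3) (by norm_num)

variable [IsProbabilityMeasure μ]

lemma integrable_cexp {S : Ω → ℝ} (hS : Measurable S) (t : ℝ) :
    Integrable (fun ω => Complex.exp ((t * S ω : ℝ) * Complex.I)) μ := by
  simpa using integrable_mul_cexp (integrable_const (1 : ℝ)) hS t (μ := μ)

/-- Stein's identity for a summand `X` of `S` which is independent of `S - U`, with `X * U`
independent of `S - V`: up to a third-order error, `𝔼[X exp(itS)] = it 𝔼[XU] 𝔼[exp(itS)]`. -/
lemma norm_integral_mul_cexp_sub_le {X U V S : Ω → ℝ} (hXm : Measurable X) (hUm : Measurable U)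
    (hVm : Measurable V) (hSm : Measurable S) (hX : MemLp X 3 μ) (hU : MemLp U 3 μ)
    (hV : MemLp V 3 μ) (h0 : ∫ ω, X ω ∂μ = 0)
    (hXU : IndepFun X (fun ω => S ω - U ω) μ)
    (hXUV : IndepFun (fun ω => X ω * U ω) (fun ω => S ω - V ω) μ)
    {M : ℝ} (hXM : ∫ ω, |X ω| ^ 3 ∂μ ≤ M) (hUM : ∫ ω, |U ω| ^ 3 ∂μ ≤ M)
    (hVM : ∫ ω, |V ω| ^ 3 ∂μ ≤ M) (t : ℝ) :
    ‖∫ ω, (X ω : ℂ) * Complex.exp ((t * S ω : ℝ) * Complex.I) ∂μ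
      - t * Complex.I * (∫ ω, X ω * U ω ∂μ : ℝ)
        * ∫ ω, Complex.exp ((t * S ω : ℝ) * Complex.I) ∂μ‖
      ≤ t ^ 2 * (5 * M + (1 + 2 * M) * (1 + M)) := by
  have iX := hX.integrable_abs_pow_three
  have iU := hU.integrable_abs_pow_three
  have iV := hV.integrable_abs_pow_three
  have hM : 0 ≤ M := le_trans (integral_nonneg fun ω => by positivity) hXM
  have i1X : Integrable (fun ω => 1 + |X ω| ^ 3) μ := (integrable_const _).add iX
  have hX1 : Integrable X μ := hX.integrable (by norm_num)
  have iXU : Integrable (fun ω => X ω * U ω) μ := by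
    refine MemLp.integrable_mul (p := 2) (q := 2) (hX.mono_exponent ?_) (hU.mono_exponent ?_) <;>
    exact_mod_cast (by norm_num : (2 : ℕ) ≤ 3)
  set ρ : ℝ := ∫ ω, X ω * U ω ∂μ with hρ
  have hρM : |ρ| ≤ 1 + 2 * M := by
    refine (abs_integral_le_integral_abs).trans ?_
    calc _ ≤ ∫ ω, (1 + |X ω| ^ 3 + |U ω| ^ 3) ∂μ :=
          integral_mono iXU.abs (i1X.add iU)
            fun ω => abs_mul_le_one_add _ _
      _ = 1 + ∫ ω, |X ω| ^ 3 ∂μ + ∫ ω, |U ω| ^ 3 ∂μ := by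
          rw [integral_add i1X iU, integral_add (integrable_const _) iX]
          simp
      _ ≤ _ := by linarith
  have i1 := integrable_mul_cexp hX1 hSm t
  have i2 := integrable_mul_cexp hX1 (hSm.sub hUm) t
  have i3 := (integrable_mul_cexp (iXU.sub (integrable_const ρ)) (hSm.sub hVm) t).const_mul
    (t * Complex.I : ℂ)
  have i4 := (integrable_cexp hSm t (μ := μ)).const_mul (t * Complex.I * ρ : ℂ)
  have z2 := integral_mul_cexp_eq_zero hXm (hSm.sub hUm) hXU h0 t
  have z3 := integral_mul_cexp_eq_zero ((hXm.mul hUm).sub_const ρ) (hSm.sub hVm)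
    (hXUV.comp (measurable_id.sub_const ρ) measurable_id)
    (by
      have := integral_sub iXU (integrable_const ρ)
      simp only [integral_const, probReal_univ, one_smul, ← hρ, sub_self] at this
      exact this) t
  have key : ∫ ω, (X ω : ℂ) * Complex.exp ((t * S ω : ℝ) * Complex.I) ∂μ
      - t * Complex.I * ρ * ∫ ω, Complex.exp ((t * S ω : ℝ) * Complex.I) ∂μ
      = ∫ ω, ((X ω : ℂ) * Complex.exp ((t * S ω : ℝ) * Complex.I)
      - X ω * Complex.exp ((t * (S ω - U ω) : ℝ) * Complex.I)
      - t * Complex.I * ((X ω * U ω - ρ : ℝ) * Complex.exp ((t * (S ω - V ω) : ℝ) * Complex.I))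
      - t * Complex.I * ρ * Complex.exp ((t * S ω : ℝ) * Complex.I)) ∂μ := by
    refine Eq.symm ((integral_sub ((i1.sub i2).sub i3) i4).trans ?_)
    rw [integral_const_mul]
    congr 1
    refine (integral_sub (i1.sub i2) i3).trans ?_
    rw [integral_const_mul]
    refine (congrArg₂ _ (integral_sub i1 i2) rfl).trans ?_
    erw [z2, z3]
    simp
  rw [key]
  have j1 : Integrable (fun ω => 2 * |X ω| ^ 3 + 2 * |U ω| ^ 3) μ :=
    (iX.const_mul 2).add (iU.const_mul 2)
  have j2 : Integrable (fun ω => 2 * |X ω| ^ 3 + 2 * |U ω| ^ 3 + |V ω| ^ 3) μ := j1.add iV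
  have j3 : Integrable (fun ω => |ρ| * (1 + |V ω| ^ 3)) μ :=
    ((integrable_const (1 : ℝ)).add iV).const_mul |ρ|
  have ib : Integrable (fun ω => t ^ 2 * (2 * |X ω| ^ 3 + 2 * |U ω| ^ 3 + |V ω| ^ 3
      + |ρ| * (1 + |V ω| ^ 3))) μ := (j2.add j3).const_mul _
  refine (norm_integral_le_of_norm_le ib (ae_of_all _ fun ω =>
    (norm_stein_integrand_le t (X ω) (U ω) (V ω) (S ω) ρ).trans
      (mul_le_mul_of_nonneg_left (third_order_le _ _ _ _) (sq_nonneg t)))).trans ?_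
  rw [integral_const_mul]
  gcongr
  rw [integral_add j2 j3, integral_add j1 iV, integral_add (iX.const_mul 2) (iU.const_mul 2),
    integral_const_mul, integral_const_mul, integral_const_mul,
    integral_add (integrable_const (1 : ℝ)) iV]
  simp only [integral_const, probReal_univ, one_smul]
  have : |ρ| * (1 + ∫ ω, |V ω| ^ 3 ∂μ) ≤ (1 + 2 * M) * (1 + M) := by
    have : 0 ≤ ∫ ω, |V ω| ^ 3 ∂μ := integral_nonneg fun ω => by positivity
    gcongr
  linarith

lemma hasDerivAt_integral_cexp {S : Ω → ℝ} (hSm : Measurable S) (hS : Integrable S μ) (t : ℝ) :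
    HasDerivAt (fun t : ℝ => ∫ ω, Complex.exp ((t * S ω : ℝ) * Complex.I) ∂μ)
      (∫ ω, Complex.I * (S ω * Complex.exp ((t * S ω : ℝ) * Complex.I)) ∂μ) t := by
  refine (hasDerivAt_integral_of_dominated_loc_of_deriv_le (s := Set.univ) (bound := fun ω => |S ω|)
    (F' := fun t ω => Complex.I * (S ω * Complex.exp ((t * S ω : ℝ) * Complex.I)))
    Filter.univ_mem ?_ (integrable_cexp hSm t) ?_ ?_ hS.abs ?_).2
  · exact .of_forall fun t => Measurable.aestronglyMeasurable (by fun_prop)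
  · exact Measurable.aestronglyMeasurable (by fun_prop)
  · refine ae_of_all _ fun ω x _ => ?_
    rw [norm_mul, norm_mul, Complex.norm_exp_ofReal_mul_I]
    simp
  · refine ae_of_all _ fun ω x _ => ?_
    have h1 : HasDerivAt (fun y : ℝ => ((y * S ω : ℝ) : ℂ) * Complex.I) (S ω * Complex.I) x := by
      have := ((hasDerivAt_id x).mul_const (S ω)).ofReal_comp.mul_const Complex.I
      simpa using this
    convert! h1.cexp using 1
    ring

/-- Stability of the equation `f' = - v t f`, `f 0 = 1`, whose solution is `exp (-v t² / 2)`.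
The error stays free of `v`, since the integrating factor `exp (v t² / 2)` is largest at `t`. -/
lemma norm_sub_exp_le_of_deriv {f f' : ℝ → ℂ} {v C : ℝ} (hv : 0 ≤ v) (h0 : f 0 = 1)
    (hf : ∀ t, HasDerivAt f (f' t) t) (hf' : ∀ t, ‖f' t + v * t * f t‖ ≤ C * t ^ 2) (t : ℝ) :
    ‖f t - Complex.exp (-(v * t ^ 2 / 2 : ℝ))‖ ≤ C * |t| ^ 3 := by
  have hC : 0 ≤ C := by simpa using (norm_nonneg _).trans (hf' 1)
  -- The integrating factor turns the perturbed equation into a bound on the derivative of `g`.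
  set g : ℝ → ℂ := fun s => f s * Complex.exp (v * s ^ 2 / 2 : ℝ)
  have hg : ∀ s, HasDerivAt g ((f' s + v * s * f s) * Complex.exp (v * s ^ 2 / 2 : ℝ)) s := by
    intro s
    have h1 : HasDerivAt (fun s : ℝ => v * s ^ 2 / 2) (v * s) s := by
      refine (((hasDerivAt_pow 2 s).const_mul v).div_const 2).congr_deriv ?_
      push_cast; ring
    have := (hf s).mul h1.ofReal_comp.cexp
    convert! this using 1
    push_cast; ring
  have hnorm : ∀ s : ℝ, ‖Complex.exp (v * s ^ 2 / 2 : ℝ)‖ = Real.exp (v * s ^ 2 / 2) := fun s => by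
    rw [Complex.norm_exp, Complex.ofReal_re]
  have hb : ‖g t - g 0‖ ≤ C * t ^ 2 * Real.exp (v * t ^ 2 / 2) * ‖t - 0‖ := by
    refine (convex_Icc (-|t|) |t|).norm_image_sub_le_of_norm_hasDerivWithin_le
      (fun s _ => (hg s).hasDerivWithinAt) (fun s hs => ?_) (by simp)
      (by simp [neg_abs_le, le_abs_self])
    have hst : s ^ 2 ≤ t ^ 2 := sq_le_sq.2 (abs_le.2 hs)
    rw [norm_mul, hnorm]
    refine mul_le_mul ((hf' s).trans (by gcongr)) (by gcongr) (by positivity) (by positivity)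
  have he : f t - Complex.exp (-(v * t ^ 2 / 2 : ℝ))
      = (g t - g 0) * Complex.exp (-(v * t ^ 2 / 2 : ℝ)) := by
    simp only [g, h0, sub_mul, mul_assoc, ← Complex.exp_add]
    simp
  rw [he, norm_mul, Complex.norm_exp, ← Complex.ofReal_neg, Complex.ofReal_re]
  calc _ ≤ C * t ^ 2 * Real.exp (v * t ^ 2 / 2) * ‖t - 0‖ * Real.exp (-(v * t ^ 2 / 2)) := by
        gcongr
    _ = C * t ^ 2 * |t| * (Real.exp (v * t ^ 2 / 2) * Real.exp (-(v * t ^ 2 / 2))) := by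
        rw [sub_zero, Real.norm_eq_abs]; ring
    _ = C * |t| ^ 3 := by
        rw [← Real.exp_add, add_neg_cancel, Real.exp_zero, ← sq_abs]; ring

/-- Quantitative normal approximation of the characteristic function of a sum of locally dependent
random variables: each `X i` is independent of `S - U i` and `X i * U i` of `S - V i`, where `S` is
the sum. -/
theorem norm_integral_cexp_sum_sub_le {ι : Type*} (s : Finset ι) {X U V : ι → Ω → ℝ}
    (hXm : ∀ i, Measurable (X i)) (hUm : ∀ i, Measurable (U i)) (hVm : ∀ i, Measurable (V i))
    (hX : ∀ i, MemLp (X i) 3 μ) (hU : ∀ i, MemLp (U i) 3 μ) (hV : ∀ i, MemLp (V i) 3 μ)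
    (h0 : ∀ i, ∫ ω, X i ω ∂μ = 0)
    (hXU : ∀ i ∈ s, IndepFun (X i) (fun ω => ∑ j ∈ s, X j ω - U i ω) μ)
    (hXUV : ∀ i ∈ s, IndepFun (fun ω => X i ω * U i ω) (fun ω => ∑ j ∈ s, X j ω - V i ω) μ)
    {M : ℝ} (hXM : ∀ i, ∫ ω, |X i ω| ^ 3 ∂μ ≤ M) (hUM : ∀ i, ∫ ω, |U i ω| ^ 3 ∂μ ≤ M)
    (hVM : ∀ i, ∫ ω, |V i ω| ^ 3 ∂μ ≤ M) (t : ℝ) :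
    ‖∫ ω, Complex.exp ((t * ∑ j ∈ s, X j ω : ℝ) * Complex.I) ∂μ
      - Complex.exp (-((variance (fun ω => ∑ j ∈ s, X j ω) μ) * t ^ 2 / 2 : ℝ))‖
      ≤ s.card * (5 * M + (1 + 2 * M) * (1 + M)) * |t| ^ 3 := by
  set S : Ω → ℝ := fun ω => ∑ j ∈ s, X j ω with hS
  have hSm : Measurable S := by fun_prop
  have hS3 : MemLp S 3 μ := memLp_finsetSum s fun i _ => hX i
  have le23 : (2 : ENNReal) ≤ 3 := by exact_mod_cast (by norm_num : (2 : ℕ) ≤ 3)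
  have hX1 : ∀ i, Integrable (X i) μ := fun i => (hX i).integrable (by norm_num)
  have hS0 : ∫ ω, S ω ∂μ = 0 := by
    rw [hS, integral_finsetSum _ fun i _ => hX1 i]; simp [h0]
  -- Each `X i` is uncorrelated with `S - U i`, so the local covariances add up to the variance.
  have hvar : variance S μ = ∑ i ∈ s, ∫ ω, X i ω * U i ω ∂μ := by
    rw [variance_of_integral_eq_zero hSm.aemeasurable hS0]
    have : ∀ i ∈ s, ∫ ω, X i ω * U i ω ∂μ = ∫ ω, X i ω * S ω ∂μ := by
      intro i hi
      have h1 := (hXU i hi).integral_fun_mul_eq_mul_integral (hXm i).aestronglyMeasurable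
        (Measurable.aestronglyMeasurable (by fun_prop))
      have iU : Integrable (fun ω => X i ω * U i ω) μ :=
        MemLp.integrable_mul (p := 2) (q := 2) ((hX i).mono_exponent le23)
          ((hU i).mono_exponent le23)
      have iS : Integrable (fun ω => X i ω * S ω) μ :=
        MemLp.integrable_mul (p := 2) (q := 2) ((hX i).mono_exponent le23)
          (hS3.mono_exponent le23)
      rw [h0 i, zero_mul] at h1
      have h2 := integral_sub iS iU
      simp only [← mul_sub] at h2
      rw [h1] at h2
      linarith
    rw [Finset.sum_congr rfl this, ← integral_finsetSum]
    · refine integral_congr_ae (ae_of_all _ fun ω => ?_)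
      simp only [hS, ← Finset.sum_mul, pow_two]
    · intro i _
      exact MemLp.integrable_mul (p := 2) (q := 2) ((hX i).mono_exponent le23)
          (hS3.mono_exponent le23)
  refine norm_sub_exp_le_of_deriv
    (f := fun t : ℝ => ∫ ω, Complex.exp ((t * S ω : ℝ) * Complex.I) ∂μ)
    (variance_nonneg _ _) (by simp)
    (fun t => hasDerivAt_integral_cexp hSm (hS3.integrable (by norm_num)) t) (fun t => ?_) t
  have e1 : ∫ ω, Complex.I * (S ω * Complex.exp ((t * S ω : ℝ) * Complex.I)) ∂μ
      = Complex.I * ∑ i ∈ s, ∫ ω, (X i ω : ℂ) * Complex.exp ((t * S ω : ℝ) * Complex.I) ∂μ := by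
    rw [integral_const_mul, ← integral_finsetSum _ fun i _ => integrable_mul_cexp (hX1 i) hSm t]
    congr 1
    refine integral_congr_ae (ae_of_all _ fun ω => ?_)
    simp only [← Finset.sum_mul]
    congr 1
    simp [hS]
  have e2 : ∫ ω, Complex.I * (S ω * Complex.exp ((t * S ω : ℝ) * Complex.I)) ∂μ
      + (variance S μ : ℝ) * t * ∫ ω, Complex.exp ((t * S ω : ℝ) * Complex.I) ∂μ
      = Complex.I * ∑ i ∈ s, (∫ ω, (X i ω : ℂ) * Complex.exp ((t * S ω : ℝ) * Complex.I) ∂μ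
        - t * Complex.I * (∫ ω, X i ω * U i ω ∂μ : ℝ)
        * ∫ ω, Complex.exp ((t * S ω : ℝ) * Complex.I) ∂μ) := by
    rw [e1, hvar, Finset.sum_sub_distrib, ← Finset.sum_mul, ← Finset.mul_sum, mul_sub]
    push_cast
    linear_combination ((t : ℂ) * (∑ i ∈ s, ((∫ ω, X i ω * U i ω ∂μ : ℝ) : ℂ))
      * ∫ ω, Complex.exp (t * S ω * Complex.I) ∂μ) * Complex.I_sq
  rw [e2, norm_mul, Complex.norm_I, one_mul]
  refine (norm_sum_le_of_le s fun i hi => norm_integral_mul_cexp_sub_le (hXm i) (hUm i) (hVm i) hSm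
    (hX i) (hU i) (hV i) (h0 i) (hXU i hi) (hXUV i hi) (hXM i) (hUM i) (hVM i) t).trans ?_
  rw [Finset.sum_const, nsmul_eq_mul]
  apply le_of_eq
  ring

end Stein

/-! ### Cubes and neighbourhoods in `ℤ^d` -/

lemma card_box (d L : ℕ) : (box d L).card = (2 * L + 1) ^ d := by
  simp only [box, Fintype.card_piFinset_const, Int.card_Icc]
  congr 1
  omega

lemma mem_box {d L : ℕ} {i : Fin d → ℤ} : i ∈ box d L ↔ ∀ v, |i v| ≤ L := by
  simp [box, abs_le]

lemma abs_le_l1Norm {d : ℕ} (n : Fin d → ℤ) (v : Fin d) : |n v| ≤ l1Norm n :=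
  Finset.single_le_sum (f := fun v => |n v|) (fun _ _ => abs_nonneg _) (Finset.mem_univ v)

lemma l1Norm_zero {d : ℕ} : l1Norm (0 : Fin d → ℤ) = 0 := by simp [l1Norm]

lemma l1Norm_sub_comm {d : ℕ} (i j : Fin d → ℤ) : l1Norm (i - j) = l1Norm (j - i) := by
  simp [l1Norm, abs_sub_comm]

lemma l1Norm_sub_le {d : ℕ} (i j k : Fin d → ℤ) :
    l1Norm (i - k) ≤ l1Norm (i - j) + l1Norm (j - k) := by
  simp only [l1Norm, ← Finset.sum_add_distrib, Pi.sub_apply]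
  exact Finset.sum_le_sum fun v _ => abs_sub_le _ _ _

lemma mem_box_of_l1Norm_le {d r : ℕ} {n : Fin d → ℤ} (h : l1Norm n ≤ r) : n ∈ box d r :=
  mem_box.2 fun v => (abs_le_l1Norm n v).trans h

/-- The sites of `s` at `ℓ¹`-distance at most `r` from `i`. -/
def nbhd {d : ℕ} (s : Finset (Fin d → ℤ)) (r : ℕ) (i : Fin d → ℤ) : Finset (Fin d → ℤ) :=
  s.filter fun j => l1Norm (i - j) ≤ r

lemma card_nbhd_le {d : ℕ} (s : Finset (Fin d → ℤ)) {r R : ℕ} (h : r ≤ R) (i : Fin d → ℤ) :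
    (nbhd s r i).card ≤ (2 * R + 1) ^ d := by
  rw [← card_box]
  refine Finset.card_le_card_of_injOn (fun j => i - j) (fun j hj => ?_)
    (fun a _ b _ hab => sub_right_injective hab)
  exact mem_box_of_l1Norm_le ((Finset.mem_filter.1 hj).2.trans (by exact_mod_cast h))

/-! ### The central limit theorem for `m`-dependent arrays -/

section Array

variable {Ω : Type*} [MeasurableSpace Ω] {μ : Measure Ω}
  {d m : ℕ} {Y : (Fin d → ℤ) → Ω → ℝ}

lemma sum_sub_sum_nbhd (s : Finset (Fin d → ℤ)) (r : ℕ) (i : Fin d → ℤ) (y : (Fin d → ℤ) → ℝ) :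
    ∑ j ∈ s, y j - ∑ j ∈ nbhd s r i, y j = ∑ j ∈ s.filter fun j => ¬ l1Norm (i - j) ≤ r, y j := by
  rw [sub_eq_iff_eq_add', nbhd, Finset.sum_filter_add_sum_filter_not]

lemma measurable_eval_singleton {ι : Type*} (i : ι) :
    Measurable fun f : ({i} : Finset ι) → ℝ => f ⟨i, Finset.mem_singleton_self i⟩ :=
  measurable_pi_apply _

lemma IsMDependent.indepFun_sub_sum_nbhd (hdep : IsMDependent m Y μ) (s : Finset (Fin d → ℤ))
    (i : Fin d → ℤ) :
    IndepFun (Y i) (fun ω => ∑ j ∈ s, Y j ω - ∑ j ∈ nbhd s m i, Y j ω) μ := by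
  simp_rw [sum_sub_sum_nbhd]
  have h := hdep {i} (s.filter fun j => ¬ l1Norm (i - j) ≤ m) (by
    intro a ha b hb
    rw [Finset.mem_singleton.1 ha]
    exact not_le.1 (Finset.mem_filter.1 hb).2)
  have := h.comp (measurable_eval_singleton i) (ψ := fun f => ∑ j, f j) (by fun_prop)
  convert! this using 2 with ω
  exact (Finset.sum_coe_sort _ fun j => Y j ω).symm

lemma IsMDependent.indepFun_mul_sum_nbhd (hdep : IsMDependent m Y μ) {s : Finset (Fin d → ℤ)}
    {i : Fin d → ℤ} (hi : i ∈ s) :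
    IndepFun (fun ω => Y i ω * ∑ j ∈ nbhd s m i, Y j ω)
      (fun ω => ∑ j ∈ s, Y j ω - ∑ j ∈ nbhd s (2 * m) i, Y j ω) μ := by
  simp_rw [sum_sub_sum_nbhd]
  have h := hdep (nbhd s m i) (s.filter fun j => ¬ l1Norm (i - j) ≤ (2 * m : ℕ)) (by
    intro a ha b hb
    have h1 := (Finset.mem_filter.1 ha).2
    have h2 := not_le.1 (Finset.mem_filter.1 hb).2
    have h3 := l1Norm_sub_le i a b
    push_cast at h2
    linarith)
  have hi' : i ∈ nbhd s m i := Finset.mem_filter.2 ⟨hi, by simp [l1Norm_zero]⟩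
  have := h.comp (φ := fun f => f ⟨i, hi'⟩ * ∑ j, f j) (ψ := fun f => ∑ j, f j)
    (by fun_prop) (by fun_prop)
  convert! this using 2 with ω ω
  · simp only [Function.comp]
    rw [Finset.sum_coe_sort _ fun j => Y j ω]
  · exact (Finset.sum_coe_sort _ fun j => Y j ω).symm

lemma integral_abs_sum_pow_three_le {ι : Type*} {X : ι → Ω → ℝ}
    (hX : ∀ i, Integrable (fun ω => |X i ω| ^ 3) μ) {M : ℝ}
    (hM : ∀ i, ∫ ω, |X i ω| ^ 3 ∂μ ≤ M) (s : Finset ι) :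
    ∫ ω, |∑ i ∈ s, X i ω| ^ 3 ∂μ ≤ s.card ^ 3 * M := by
  have hp : ∀ ω, |∑ i ∈ s, X i ω| ^ 3 ≤ s.card ^ 2 * ∑ i ∈ s, |X i ω| ^ 3 := by
    intro ω
    refine (pow_le_pow_left₀ (abs_nonneg _) (Finset.abs_sum_le_sum_abs _ _) 3).trans ?_
    rcases s.eq_empty_or_nonempty with rfl | hs
    · simp
    have hc : (0 : ℝ) < (s.card : ℝ) ^ 2 := by
      have : 0 < s.card := hs.card_pos
      positivity
    have := pow_sum_div_card_le_sum_pow (s := s) (f := fun i => |X i ω|)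
      (fun _ _ => abs_nonneg _) 2
    rwa [div_le_iff₀' hc] at this
  calc _ ≤ ∫ ω, (s.card : ℝ) ^ 2 * ∑ i ∈ s, |X i ω| ^ 3 ∂μ :=
        integral_mono_of_nonneg (ae_of_all _ fun ω => by positivity)
          ((integrable_finsetSum s fun i _ => hX i).const_mul _) (ae_of_all _ hp)
    _ = (s.card : ℝ) ^ 2 * ∑ i ∈ s, ∫ ω, |X i ω| ^ 3 ∂μ := by
        rw [integral_const_mul, integral_finsetSum s fun i _ => hX i]
    _ ≤ (s.card : ℝ) ^ 2 * ∑ i ∈ s, M := by gcongr with i; exact hM i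
    _ = _ := by rw [Finset.sum_const, nsmul_eq_mul]; ring

lemma memLp_three_of_integrable {X : Ω → ℝ} (hXm : Measurable X)
    (hX : Integrable (fun ω => |X ω| ^ 3) μ) : MemLp X 3 μ := by
  rw [← integrable_norm_rpow_iff hXm.aestronglyMeasurable (by norm_num) (by norm_num)]
  refine hX.congr (ae_of_all _ fun ω => ?_)
  simp only [Real.norm_eq_abs, ENNReal.toReal_ofNat]
  exact_mod_cast (Real.rpow_natCast |X ω| 3).symm

/-- The characteristic function of the sum of an `m`-dependent array over a finite set `s` is
within `C * #s * |t|³` of that of the centred Gaussian of the same variance, with `C` independent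
of `s`. -/
theorem IsMDependent.exists_norm_integral_cexp_sub_le [IsProbabilityMeasure μ]
    (hdep : IsMDependent m Y μ) (hmeas : ∀ i, Measurable (Y i))
    (hmean : ∀ i, ∫ ω, Y i ω ∂μ = 0) (hmom : ∀ i, Integrable (fun ω => |Y i ω| ^ 3) μ)
    {M : ℝ} (hM : ∀ i, ∫ ω, |Y i ω| ^ 3 ∂μ ≤ M) :
    ∃ C : ℝ, ∀ (s : Finset (Fin d → ℤ)) (t : ℝ),
      ‖∫ ω, Complex.exp ((t * ∑ j ∈ s, Y j ω : ℝ) * Complex.I) ∂μ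
        - Complex.exp (-((variance (fun ω => ∑ j ∈ s, Y j ω) μ) * t ^ 2 / 2 : ℝ))‖
        ≤ s.card * C * |t| ^ 3 := by
  have hM0 : 0 ≤ M := le_trans (integral_nonneg fun ω => by positivity) (hM 0)
  -- A common bound for the third moments of the sums over neighbourhoods of radius `m` and `2 * m`.
  set K : ℝ := (((2 * (2 * m) + 1) ^ d : ℕ) : ℝ) ^ 3 * M
  have hL : ∀ i, MemLp (Y i) 3 μ := fun i => memLp_three_of_integrable (hmeas i) (hmom i)
  have hN : ∀ (s : Finset (Fin d → ℤ)) (r : ℕ), r ≤ 2 * m → ∀ i,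
      ∫ ω, |∑ j ∈ nbhd s r i, Y j ω| ^ 3 ∂μ ≤ K := fun s r hr i => by
    refine (integral_abs_sum_pow_three_le hmom hM _).trans ?_
    have := card_nbhd_le s hr i
    simp only [K]
    gcongr
  refine ⟨_, fun s t => norm_integral_cexp_sum_sub_le s
    (U := fun i ω => ∑ j ∈ nbhd s m i, Y j ω) (V := fun i ω => ∑ j ∈ nbhd s (2 * m) i, Y j ω)
    hmeas (fun i => by fun_prop) (fun i => by fun_prop) hL
    (fun i => memLp_finsetSum _ fun j _ => hL j) (fun i => memLp_finsetSum _ fun j _ => hL j)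
    hmean (fun i _ => hdep.indepFun_sub_sum_nbhd s i) (fun i hi => hdep.indepFun_mul_sum_nbhd hi)
    (M := K) (fun i => (hM i).trans ?_) (fun i => hN s m (by omega) i)
    (fun i => hN s (2 * m) le_rfl i) t⟩
  refine le_mul_of_one_le_left hM0 (one_le_pow₀ ?_)
  exact_mod_cast Nat.one_le_pow _ _ (by omega)

theorem IsMDependent.tendstoInDistribution_normalizedBoxSum [IsProbabilityMeasure μ]
    (hdep : IsMDependent m Y μ) (hd : 1 ≤ d) (hmeas : ∀ i, Measurable (Y i))
    (hmean : ∀ i, ∫ ω, Y i ω ∂μ = 0) (hmom : ∀ i, Integrable (fun ω => |Y i ω| ^ 3) μ)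
    {M : ℝ} (hM : ∀ i, ∫ ω, |Y i ω| ^ 3 ∂μ ≤ M) {σsq : ℝ≥0}
    (hσ : Tendsto (normalizedVariance Y μ) atTop (𝓝 (σsq : ℝ))) :
    TendstoInDistribution (normalizedBoxSum Y) atTop (id : ℝ → ℝ) (fun _ => μ)
      (gaussianReal 0 σsq) where
  forall_aemeasurable L := by
    refine Measurable.aemeasurable ?_
    unfold normalizedBoxSum boxSum
    fun_prop
  tendsto := by
    refine ProbabilityMeasure.tendsto_iff_tendsto_charFun.2 fun t => ?_
    obtain ⟨C, hC⟩ := hdep.exists_norm_integral_cexp_sub_le hmeas hmean hmom hM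
    set c : ℕ → ℝ := fun L => 1 / (2 * (L : ℝ) + 1) ^ ((d : ℝ) / 2)
    have hc0 : ∀ L, 0 ≤ c L := fun L => by positivity
    have hc2 : ∀ L, c L ^ 2 = 1 / (2 * (L : ℝ) + 1) ^ d := fun L => by
      simp only [c]
      rw [div_pow, one_pow, ← Real.rpow_natCast, ← Real.rpow_mul (by positivity)]
      norm_num
    have hclim : Tendsto c atTop (𝓝 0) := by
      have h1 : Tendsto (fun L : ℕ => 2 * (L : ℝ) + 1) atTop atTop :=
        tendsto_atTop_add_const_right _ _
          (tendsto_natCast_atTop_atTop.const_mul_atTop (by norm_num))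
      have hd' : (0 : ℝ) < (d : ℝ) / 2 := by
        have : (0 : ℝ) < d := by exact_mod_cast hd
        positivity
      simp only [c, one_div]
      exact ((tendsto_rpow_atTop hd').comp h1).inv_tendsto_atTop
    have hchar : ∀ L, charFun (μ.map (normalizedBoxSum Y L)) t
        = ∫ ω, Complex.exp ((t * c L * ∑ j ∈ box d L, Y j ω : ℝ) * Complex.I) ∂μ := fun L => by
      rw [charFun_apply_real, integral_map]
      · refine integral_congr_ae (ae_of_all _ fun ω => ?_)
        simp only [normalizedBoxSum, boxSum, c]
        push_cast
        ring_nf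
      · refine Measurable.aemeasurable ?_
        unfold normalizedBoxSum boxSum
        fun_prop
      · exact Measurable.aestronglyMeasurable (by fun_prop)
    have hbound : ∀ L, ‖charFun (μ.map (normalizedBoxSum Y L)) t
        - Complex.exp (-(normalizedVariance Y μ L * t ^ 2 / 2 : ℝ))‖ ≤ C * |t| ^ 3 * c L := by
      intro L
      have h := hC (box d L) (t * c L)
      rw [← hchar L] at h
      have e1 : variance (fun ω => ∑ j ∈ box d L, Y j ω) μ * (t * c L) ^ 2 / 2
          = normalizedVariance Y μ L * t ^ 2 / 2 := by
        rw [mul_pow, hc2]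
        change _ = 1 / (2 * (L : ℝ) + 1) ^ d * variance (fun ω => ∑ j ∈ box d L, Y j ω) μ * t ^ 2 / 2
        ring
      rw [e1] at h
      refine h.trans (le_of_eq ?_)
      -- The error is `#Λ * c³ = c`, which vanishes as `L → ∞` because `d ≥ 1`.
      have h2 : ((box d L).card : ℝ) * c L ^ 2 = 1 := by
        rw [hc2, card_box]
        push_cast
        field_simp
      rw [abs_mul, mul_pow, abs_of_nonneg (hc0 L)]
      linear_combination (C * |t| ^ 3 * c L) * h2
    have hlim : Tendsto (fun L => Complex.exp (-(normalizedVariance Y μ L * t ^ 2 / 2 : ℝ))) atTop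
        (𝓝 (Complex.exp (-(σsq * t ^ 2 / 2 : ℝ)))) := by
      have : Continuous fun x : ℝ => Complex.exp (-(x * t ^ 2 / 2 : ℝ)) := by fun_prop
      exact (this.tendsto _).comp hσ
    have hdiff := squeeze_zero_norm hbound (by simpa using hclim.const_mul (C * |t| ^ 3))
    have := hdiff.add hlim
    simp only [sub_add_cancel, zero_add] at this
    simp only [ProbabilityMeasure.coe_mk, Measure.map_id, charFun_gaussianReal]
    convert! this using 2
    push_cast
    ring_nf

/-! ### Convergence of the variance in the stationary case -/

lemma IsMDependent.integral_mul_eq_zero (hdep : IsMDependent m Y μ) (hmeas : ∀ i, Measurable (Y i))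
    (hmean : ∀ i, ∫ ω, Y i ω ∂μ = 0) {i j : Fin d → ℤ} (h : (m : ℤ) < l1Norm (i - j)) :
    ∫ ω, Y i ω * Y j ω ∂μ = 0 := by
  have h1 := (hdep {i} {j} (by simpa using h)).comp (measurable_eval_singleton i)
    (measurable_eval_singleton j)
  have h2 := h1.integral_fun_mul_eq_mul_integral
    (hmeas i).aestronglyMeasurable (hmeas j).aestronglyMeasurable
  refine h2.trans ?_
  exact mul_eq_zero_of_left (hmean i) _

lemma IsStationaryArray.integral_mul_eq (hstat : IsStationaryArray Y μ) (i j : Fin d → ℤ) :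
    ∫ ω, Y i ω * Y j ω ∂μ = ∫ ω, Y 0 ω * Y (j - i) ω ∂μ := by
  have := ((hstat i).comp (u := fun y : (Fin d → ℤ) → ℝ => y 0 * y (j - i))
    (by fun_prop)).integral_eq
  simpa [Function.comp_def] using this

/-- As `L → ∞`, the proportion of sites of the cube staying in it under translation by `k` tends
to `1`. -/
lemma tendsto_card_translate_div (d : ℕ) {m : ℕ} {k : Fin d → ℤ} (hk : k ∈ box d m) :
    Tendsto (fun L : ℕ => (((box d L).filter fun i => i + k ∈ box d L).card : ℝ)
      / (2 * (L : ℝ) + 1) ^ d) atTop (𝓝 1) := by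
  have hlow : Tendsto (fun L : ℕ => (1 - (2 * m : ℝ) / (2 * (L : ℝ) + 1)) ^ d) atTop (𝓝 1) := by
    have h1 : Tendsto (fun L : ℕ => 2 * (L : ℝ) + 1) atTop atTop :=
      tendsto_atTop_add_const_right _ _
        (tendsto_natCast_atTop_atTop.const_mul_atTop (by norm_num))
    simpa using ((h1.const_div_atTop (2 * m : ℝ)).const_sub 1).pow d
  refine tendsto_of_tendsto_of_tendsto_of_le_of_le' hlow tendsto_const_nhds ?_ ?_
  · filter_upwards [eventually_ge_atTop m] with L hL
    have hsub : box d (L - m) ⊆ (box d L).filter fun i => i + k ∈ box d L := by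
      intro i hi
      rw [mem_box] at hi hk
      rw [Finset.mem_filter, mem_box, mem_box]
      have hc : ((L - m : ℕ) : ℤ) = L - m := by omega
      refine ⟨fun v => (hi v).trans (by omega), fun v => (abs_add_le _ _).trans ?_⟩
      have := hi v
      have := hk v
      omega
    have hcard := Finset.card_le_card hsub
    rw [card_box] at hcard
    have hpos : (0 : ℝ) < 2 * (L : ℝ) + 1 := by positivity
    have e : 1 - (2 * m : ℝ) / (2 * (L : ℝ) + 1)
        = ((2 * (L - m) + 1 : ℕ) : ℝ) / (2 * (L : ℝ) + 1) := by
      push_cast [Nat.cast_sub hL]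
      field_simp
      ring
    rw [e, div_pow]
    gcongr
    exact_mod_cast hcard
  · refine .of_forall fun L => div_le_one_of_le₀ ?_ (by positivity)
    have := (Finset.card_filter_le (box d L) fun i => i + k ∈ box d L).trans (card_box d L).le
    exact_mod_cast this

/-- For a stationary `m`-dependent array, the normalized variance converges to the sum of the
covariances `𝔼[Y 0 * Y k]`. -/
theorem IsMDependent.tendsto_normalizedVariance [IsProbabilityMeasure μ]
    (hdep : IsMDependent m Y μ) (hstat : IsStationaryArray Y μ) (hmeas : ∀ i, Measurable (Y i))
    (hmean : ∀ i, ∫ ω, Y i ω ∂μ = 0) (hL2 : ∀ i, MemLp (Y i) 2 μ) :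
    Tendsto (normalizedVariance Y μ) atTop
      (𝓝 (∑ k ∈ box d m, ∫ ω, Y 0 ω * Y k ω ∂μ)) := by
  set γ : (Fin d → ℤ) → ℝ := fun k => ∫ ω, Y 0 ω * Y k ω ∂μ
  have hγ0 : ∀ k, k ∉ box d m → γ k = 0 := fun k hk => by
    refine hdep.integral_mul_eq_zero hmeas hmean (lt_of_not_ge fun h => hk ?_)
    rw [l1Norm_sub_comm, sub_zero] at h
    exact mem_box_of_l1Norm_le h
  -- Reindex by `k = j - i`: only displacements in the cube of radius `m` contribute.
  have hrow : ∀ (L : ℕ) (i : Fin d → ℤ), ∑ j ∈ box d L, γ (j - i)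
      = ∑ k ∈ box d m, if i + k ∈ box d L then γ k else 0 := by
    intro L i
    rw [← Finset.sum_filter]
    refine (Finset.sum_of_injOn (fun k => i + k) (add_right_injective i).injOn ?_ ?_ ?_).symm
    · intro k hk
      exact (Finset.mem_filter.1 hk).2
    · intro j hj hj'
      exact hγ0 _ fun hm => hj' ⟨j - i,
        Finset.mem_coe.2 (Finset.mem_filter.2 ⟨hm, by rwa [add_sub_cancel]⟩), add_sub_cancel i j⟩
    · intro k _
      simp
  have hint : ∀ i j, Integrable (fun ω => Y i ω * Y j ω) μ := fun i j =>
    MemLp.integrable_mul (hL2 i) (hL2 j)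
  have hvar : ∀ L, variance (boxSum Y L) μ = ∑ i ∈ box d L, ∑ j ∈ box d L, γ (j - i) := by
    intro L
    have hbm : Measurable (boxSum Y L) := by unfold boxSum; fun_prop
    have h0 : ∫ ω, boxSum Y L ω ∂μ = 0 := by
      simp only [boxSum]
      rw [integral_finsetSum _ fun i _ => (hL2 i).integrable (by norm_num)]
      simp [hmean]
    rw [variance_of_integral_eq_zero hbm.aemeasurable h0]
    have e : ∀ ω, boxSum Y L ω ^ 2 = ∑ i ∈ box d L, ∑ j ∈ box d L, Y i ω * Y j ω := fun ω => by
      rw [boxSum, pow_two, Finset.sum_mul_sum]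
    simp only [e]
    rw [integral_finsetSum _ fun i _ => integrable_finsetSum _ fun j _ => hint i j]
    refine Finset.sum_congr rfl fun i _ => ?_
    rw [integral_finsetSum _ fun j _ => hint i j]
    exact Finset.sum_congr rfl fun j _ => hstat.integral_mul_eq i j
  have hform : normalizedVariance Y μ = fun L : ℕ => ∑ k ∈ box d m,
      γ k * ((((box d L).filter fun i => i + k ∈ box d L).card : ℝ) / (2 * (L : ℝ) + 1) ^ d) := by
    funext L
    rw [normalizedVariance, hvar, Finset.sum_congr rfl fun i _ => hrow L i, Finset.sum_comm,
      Finset.mul_sum]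
    refine Finset.sum_congr rfl fun k _ => ?_
    rw [← Finset.sum_filter, Finset.sum_const, nsmul_eq_mul]
    ring
  rw [hform]
  refine tendsto_finsetSum _ fun k hk => ?_
  simpa using (tendsto_card_translate_div d hk).const_mul (γ k)

end Array

theorem proposition5 {Ω : Type*} [MeasurableSpace Ω] (μ : Measure Ω) [IsProbabilityMeasure μ]
    (d : ℕ) (hd : 1 ≤ d) (m : ℕ) (Y : (Fin d → ℤ) → Ω → ℝ)
    (hmeas : ∀ i, Measurable (Y i))
    (hident : ∀ i j, IdentDistrib (Y i) (Y j) μ μ)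
    (hdep : IsMDependent m Y μ)
    (hmean : ∀ i, ∫ ω, Y i ω ∂μ = 0)
    (hmom : ∀ i, Integrable (fun ω => |Y i ω| ^ 3) μ) :
    (∀ σsq : ℝ≥0, Tendsto (normalizedVariance Y μ) atTop (𝓝 (σsq : ℝ)) →
      TendstoInDistribution (normalizedBoxSum Y) atTop (id : ℝ → ℝ) (fun _ => μ)
        (gaussianReal 0 σsq)) ∧
    (IsStationaryArray Y μ →
      ∃ σsq : ℝ≥0, Tendsto (normalizedVariance Y μ) atTop (𝓝 (σsq : ℝ)) ∧
        TendstoInDistribution (normalizedBoxSum Y) atTop (id : ℝ → ℝ) (fun _ => μ)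
          (gaussianReal 0 σsq)) := by
  have hM : ∀ i, ∫ ω, |Y i ω| ^ 3 ∂μ ≤ ∫ ω, |Y 0 ω| ^ 3 ∂μ := fun i =>
    ((hident i 0).comp (u := fun x : ℝ => |x| ^ 3) (by fun_prop)).integral_eq.le
  have hclt : ∀ σsq : ℝ≥0, Tendsto (normalizedVariance Y μ) atTop (𝓝 (σsq : ℝ)) →
      TendstoInDistribution (normalizedBoxSum Y) atTop (id : ℝ → ℝ) (fun _ => μ)
        (gaussianReal 0 σsq) := fun σsq hσ =>
    hdep.tendstoInDistribution_normalizedBoxSum hd hmeas hmean hmom hM hσ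
  refine ⟨hclt, fun hstat => ?_⟩
  have hlim := hdep.tendsto_normalizedVariance hstat hmeas hmean fun i =>
    (memLp_three_of_integrable (hmeas i) (hmom i)).mono_exponent
      (by exact_mod_cast (by norm_num : (2 : ℕ) ≤ 3))
  have hnn := ge_of_tendsto' hlim fun L => by
    unfold normalizedVariance
    exact mul_nonneg (by positivity) (variance_nonneg _ _)
  lift (∑ k ∈ box d m, ∫ ω, Y 0 ω * Y k ω ∂μ) to ℝ≥0 using hnn with σsq
  exact ⟨σsq, hlim, hclt σsq hlim⟩
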